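/- For integers $0\le m\le d$, a random orthonormal family of $m$ vectors in $\mathbb{C}^d$ is obtained by drawing $m$ independent random unit vectors $v'_1,\dots,v'_m\in\mathbb{C}^d$ (each a normalised vector whose coordinates have independent standard Gaussian real and imaginary parts) and orthonormalising them by the Gram--Schmidt process. There exist a function $\delta:\mathbb{N}\to\mathbb{R}$ and absolute constants $c_1,c_2>0$ with $c_1 n^{-3/2}\le\delta(n)\le c_2 n^{-3/2}$ for all $n\ge 1$ such that the following holds. For every $\alpha_0>0$ there are constants $\kappa,\eta>0$, depending only on $\alpha_0$, such that for all integers $p,q,r,d\ge 0$ with $p+r>0$, $q+r>0$ and $p+q+r\le d$, if $$\alpha:=d\,\delta(p+q+r)^2-2\log(p+q+r)\ \ge\ \alpha_0$$ (natural logarithm), then for a random orthonormal family $a^1,\dots,a^p,b^1,\dots,b^q,c^1,\dots,c^r$ of $p+q+r$ vectors in $\mathbb{C}^d$, and for the probability vectors $S,T$ on $\{1,\dots,d\}$ given by $$S_j=\frac{1}{p+r}\Big(\sum_{i=1}^p|a^i_j|^2+\sum_{i=1}^r|c^i_j|^2\Big),\qquad T_j=\frac{1}{q+r}\Big(\sum_{i=1}^q|b^i_j|^2+\sum_{i=1}^r|c^i_j|^2\Big),$$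 one has, with probability at least $1-\exp(-\kappa\alpha)$, $$\|S-T\|_1=\sum_{j=1}^d|S_j-T_j|\ \ge\ \eta\left(\frac{\sqrt p}{p+r}+\frac{\sqrt q}{q+r}\right).$$ -/

import Mathlib

open MeasureTheory ProbabilityTheory

noncomputable section

/-- The standard Gaussian law on `m` vectors of `ℂ ^ d`: the real and the imaginary parts of the
`m * d` coordinates are independent real Gaussians with mean `0` and variance `1`. -/
def gaussianFamily (d m : ℕ) : Measure (Fin m → Fin d → ℝ × ℝ) :=
  Measure.pi fun _ => Measure.pi fun _ => (gaussianReal 0 1).prod (gaussianReal 0 1)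

instance (d m : ℕ) : IsProbabilityMeasure (gaussianFamily d m) := by
  unfold gaussianFamily; infer_instance

/-- Identify pairs of real numbers with complex numbers. -/
def toComplexVector {d : ℕ} (y : Fin d → ℝ × ℝ) : EuclideanSpace ℂ (Fin d) :=
  WithLp.toLp 2 fun j => Complex.mk (y j).1 (y j).2

/-- The vector `y / ‖y‖` of `ℂ ^ d` (the zero vector, an event of probability zero for Gaussian `y`
if `0 < d`, is sent to itself). -/
def normalizedVector {d : ℕ} (y : Fin d → ℝ × ℝ) : EuclideanSpace ℂ (Fin d) :=
  ((‖toComplexVector y‖⁻¹ : ℝ) : ℂ) • toComplexVector y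

/-- Normalise `m` vectors, then orthonormalise them by the Gram-Schmidt process. -/
def orthonormalize {d m : ℕ} (y : Fin m → Fin d → ℝ × ℝ) : Fin m → EuclideanSpace ℂ (Fin d) :=
  InnerProductSpace.gramSchmidtNormed ℂ fun i => normalizedVector (y i)

/-- The law of a random orthonormal family of `m` vectors in `ℂ ^ d` (for `m ≤ d`): take `m`
independent random unit vectors, each a normalised standard Gaussian vector, and orthonormalise them
by the Gram-Schmidt process. -/
def randomOrthonormal (d m : ℕ) : Measure (Fin m → EuclideanSpace ℂ (Fin d)) :=
  (gaussianFamily d m).map orthonormalize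

theorem measurable_toComplexVector {d : ℕ} :
    Measurable (toComplexVector : (Fin d → ℝ × ℝ) → EuclideanSpace ℂ (Fin d)) := by
  have h : Measurable fun y : Fin d → ℝ × ℝ =>
      (fun j => Complex.equivRealProdCLM.symm (y j) : Fin d → ℂ) := by fun_prop
  exact (WithLp.measurable_toLp 2 (Fin d → ℂ)).comp h

theorem measurable_normalizedVector {d : ℕ} :
    Measurable (normalizedVector : (Fin d → ℝ × ℝ) → EuclideanSpace ℂ (Fin d)) := by
  have h := measurable_toComplexVector (d := d)
  unfold normalizedVector
  fun_prop

theorem measurable_gramSchmidt_apply {d m : ℕ} (i : Fin m) :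
    Measurable fun v : Fin m → EuclideanSpace ℂ (Fin d) =>
      InnerProductSpace.gramSchmidt ℂ v i := by
  induction i using WellFoundedLT.induction with
  | ind i ih =>
    simp only [InnerProductSpace.gramSchmidt_def ℂ _ i, Submodule.starProjection_singleton]
    refine (measurable_pi_apply i).sub (Finset.measurable_fun_sum _ fun k hk => ?_)
    have hk' := ih k (Finset.mem_Iio.mp hk)
    have h1 : Measurable fun v : Fin m → EuclideanSpace ℂ (Fin d) =>
        inner ℂ (InnerProductSpace.gramSchmidt ℂ v k) (v i) :=
      hk'.inner (measurable_pi_apply i)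
    have h2 : Measurable fun v : Fin m → EuclideanSpace ℂ (Fin d) =>
        ((‖InnerProductSpace.gramSchmidt ℂ v k‖ ^ 2 : ℝ) : ℂ) :=
      Complex.measurable_ofReal.comp (hk'.norm.pow_const 2)
    exact (h1.div h2).smul hk'

theorem measurable_orthonormalize {d m : ℕ} :
    Measurable (orthonormalize : (Fin m → Fin d → ℝ × ℝ) → Fin m → EuclideanSpace ℂ (Fin d)) := by
  refine measurable_pi_lambda _ fun i => ?_
  have h := (measurable_gramSchmidt_apply (d := d) i).comp
    (measurable_pi_lambda (fun y : Fin m → Fin d → ℝ × ℝ => fun i => normalizedVector (y i))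
      fun k => measurable_normalizedVector.comp (measurable_pi_apply k))
  have h' : Measurable fun y : Fin m → Fin d → ℝ × ℝ =>
      InnerProductSpace.gramSchmidt ℂ (fun i => normalizedVector (y i)) i := h
  have h1 := (Complex.measurable_ofReal.comp h'.norm).inv
  exact h1.smul h'

instance (d m : ℕ) : IsProbabilityMeasure (randomOrthonormal d m) :=
  Measure.isProbabilityMeasure_map measurable_orthonormalize.aemeasurable

section Groups

variable {d p q r : ℕ} (w : Fin (p + q + r) → EuclideanSpace ℂ (Fin d))

/-- The first `p` vectors. -/
def groupA (i : Fin p) : EuclideanSpace ℂ (Fin d) := w (Fin.castAdd r (Fin.castAdd q i))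

/-- The next `q` vectors. -/
def groupB (i : Fin q) : EuclideanSpace ℂ (Fin d) := w (Fin.castAdd r (Fin.natAdd p i))

/-- The last `r` vectors. -/
def groupC (i : Fin r) : EuclideanSpace ℂ (Fin d) := w (Fin.natAdd (p + q) i)

/-- The coordinate-weight distribution of the uniform mixture of the vectors `a` and `c`. -/
def distS (j : Fin d) : ℝ :=
  1 / ((p : ℝ) + r) * (∑ i, ‖groupA w i j‖ ^ 2 + ∑ i, ‖groupC w i j‖ ^ 2)

/-- The coordinate-weight distribution of the uniform mixture of the vectors `b` and `c`. -/
def distT (j : Fin d) : ℝ :=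
  1 / ((q : ℝ) + r) * (∑ i, ‖groupB w i j‖ ^ 2 + ∑ i, ‖groupC w i j‖ ^ 2)

end Groups

end

/-! The difference `S - T` is a linear combination, with fixed coefficients, of the vectors of
squared moduli of the entries. After dividing by the ℓ² norm of the coefficients it is enough to
bound `∑ j, |∑ i, θ i * ‖w i j‖ ^ 2|` below when `∑ i, θ i ^ 2 = 1`.

For the raw Gaussian family the `d` coordinates are independent, and the characteristic function of
each inner sum at 1 has modulus at most 1/2. This bounds the mean of `exp (-|·|)` away from 1, so
the ℓ¹ norm exceeds `d / 16` outside probability `exp (-d / 16)` (`measureReal_sum_abs_le`).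

Chernoff bounds put the Gram matrix of the `n` vectors, divided by `2d`, entrywise within `s` of the
identity (`measureReal_le_norm_inner_sub`). Gram-Schmidt then moves each scaled vector by `O(n s)`
(`norm_gramSchmidtNormed_normalize_sub_le`), and since the ℓ¹ norm of `θ` is at most `√n`, the total
error is `O(n ^ (3/2) s)`. This forces `s`, hence `δ`, to be of order `n ^ (-3/2)`. The logarithmic
term in `α` pays for the union bound over pairs. -/

/-! ### Exponential integrals of Gaussians, Markov bound and product measures. -/

/-- Squaring removes the branch of the square root; a complex Gaussian has two such factors anyway.
-/
lemma integral_cexp_mul_sq_gaussianReal_sq {z : ℂ} (hz : z.re < 1 / 2) :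
    (∫ x : ℝ, Complex.exp (z * (x : ℂ) ^ 2) ∂gaussianReal 0 1) ^ 2 = (1 - 2 * z)⁻¹ := by
  have hne : (1 / 2 - z : ℂ) ≠ 0 := fun h => by
    have := congrArg Complex.re h
    norm_num at this
    linarith
  have hre : 0 < (1 / 2 - z : ℂ).re := by
    norm_num
    linarith
  have hpi : (Real.pi : ℂ) ≠ 0 := by exact_mod_cast Real.pi_ne_zero
  have h1 : ∫ x : ℝ, Complex.exp (z * (x : ℂ) ^ 2) ∂gaussianReal 0 1 =
      ((√(2 * Real.pi))⁻¹ : ℝ) * ((Real.pi : ℂ) / (1 / 2 - z)) ^ (1 / 2 : ℂ) := by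
    rw [integral_gaussianReal_eq_integral_smul one_ne_zero, ← integral_gaussian_complex hre,
      ← integral_const_mul]
    refine integral_congr_ae (Filter.Eventually.of_forall fun x => ?_)
    simp only [gaussianPDFReal, Complex.real_smul]
    push_cast
    rw [mul_assoc, ← Complex.exp_add]
    norm_num
    left
    congr 1
    ring
  rw [h1, mul_pow, one_div (2 : ℂ), ← Nat.cast_ofNat (R := ℂ) (n := 2),
    Complex.cpow_nat_inv_pow _ two_ne_zero, ← Complex.ofReal_pow, inv_pow,
    Real.sq_sqrt (by positivity)]
  have h2 : (1 - 2 * z : ℂ) ≠ 0 := by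
    intro h
    apply hne
    linear_combination h / 2
  push_cast
  field_simp

/-- The standard Gaussian law on `ℂ = ℝ × ℝ`. -/
noncomputable abbrev complexGaussian : Measure (ℝ × ℝ) := (gaussianReal 0 1).prod (gaussianReal 0 1)

lemma integral_cexp_mul_normSq_complexGaussian {z : ℂ} (hz : z.re < 1 / 2) :
    ∫ x : ℝ × ℝ, Complex.exp (z * ((x.1 ^ 2 + x.2 ^ 2 : ℝ) : ℂ)) ∂complexGaussian =
      (1 - 2 * z)⁻¹ := by
  rw [← integral_cexp_mul_sq_gaussianReal_sq hz, sq, ← integral_prod_mul]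
  congr with x
  rw [← Complex.exp_add]
  push_cast
  ring_nf

lemma integral_exp_mul_normSq_complexGaussian {a : ℝ} (ha : a < 1 / 2) :
    ∫ x : ℝ × ℝ, Real.exp (a * (x.1 ^ 2 + x.2 ^ 2)) ∂complexGaussian = (1 - 2 * a)⁻¹ := by
  have h := integral_cexp_mul_normSq_complexGaussian (z := (a : ℂ)) (by simpa using ha)
  apply Complex.ofReal_injective
  rw [← integral_complex_ofReal]
  push_cast at h ⊢
  exact h

lemma integrable_exp_mul_normSq_complexGaussian {a : ℝ} (ha : a < 1 / 2) :
    Integrable (fun x : ℝ × ℝ => Real.exp (a * (x.1 ^ 2 + x.2 ^ 2))) complexGaussian := by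
  -- A non-integrable function has Bochner integral 0, but the computed value is nonzero, so the
  -- formula itself yields integrability.
  by_contra h
  have h1 := integral_exp_mul_normSq_complexGaussian ha
  rw [integral_undef h, eq_comm, inv_eq_zero] at h1
  linarith

lemma integral_exp_linear_complexGaussian (u v : ℝ) :
    ∫ y : ℝ × ℝ, Real.exp (u * y.1 + v * y.2) ∂complexGaussian =
      Real.exp ((u ^ 2 + v ^ 2) / 2) := by
  have h (t : ℝ) : ∫ x : ℝ, Real.exp (t * x) ∂gaussianReal 0 1 = Real.exp (t ^ 2 / 2) := by
    have := mgf_gaussianReal (p := gaussianReal 0 1) (X := id) (μ := 0) (v := 1) (by simp) t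
    simpa [mgf] using this
  simp_rw [Real.exp_add]
  rw [integral_prod_mul (fun x => Real.exp (u * x)) (fun x => Real.exp (v * x)), h, h,
    ← Real.exp_add]
  ring_nf

lemma integrable_exp_linear_complexGaussian (u v : ℝ) :
    Integrable (fun y : ℝ × ℝ => Real.exp (u * y.1 + v * y.2)) complexGaussian := by
  by_contra h
  have h1 := integral_exp_linear_complexGaussian u v
  rw [integral_undef h] at h1
  exact (Real.exp_pos _).ne h1

/-- For fixed first variable the exponent is linear in the second, and integrating gives `exp (t ^ 2
/ 2 * |x| ^ 2)`. The pair `(u, v)` covers the real and imaginary parts of an inner product, with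
either sign. -/
lemma integrable_exp_bilinear_complexGaussian {u v : ℝ × ℝ → ℝ} (hu : Measurable u)
    (hv : Measurable v) {t : ℝ} (ht : t ^ 2 < 1)
    (huv : ∀ x, u x ^ 2 + v x ^ 2 = x.1 ^ 2 + x.2 ^ 2) :
    Integrable (fun x : (ℝ × ℝ) × (ℝ × ℝ) => Real.exp (t * (u x.1 * x.2.1 + v x.1 * x.2.2)))
      (complexGaussian.prod complexGaussian) ∧
    ∫ x : (ℝ × ℝ) × (ℝ × ℝ), Real.exp (t * (u x.1 * x.2.1 + v x.1 * x.2.2))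
      ∂(complexGaussian.prod complexGaussian) = (1 - t ^ 2)⁻¹ := by
  have hrw (x y : ℝ × ℝ) : Real.exp (t * (u x * y.1 + v x * y.2)) =
      Real.exp ((t * u x) * y.1 + (t * v x) * y.2) := by ring_nf
  have hin (x : ℝ × ℝ) : ∫ y : ℝ × ℝ, Real.exp (t * (u x * y.1 + v x * y.2)) ∂complexGaussian =
      Real.exp (t ^ 2 / 2 * (x.1 ^ 2 + x.2 ^ 2)) := by
    simp_rw [hrw]
    rw [integral_exp_linear_complexGaussian, ← huv x]
    ring_nf
  have hi : Integrable
      (fun x : (ℝ × ℝ) × (ℝ × ℝ) => Real.exp (t * (u x.1 * x.2.1 + v x.1 * x.2.2)))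
      (complexGaussian.prod complexGaussian) := by
    refine (integrable_prod_iff (μ := complexGaussian) (ν := complexGaussian)
      (Measurable.aestronglyMeasurable (by fun_prop))).2 ⟨Filter.Eventually.of_forall fun x => ?_, ?_⟩
    · simp_rw [hrw]
      exact integrable_exp_linear_complexGaussian _ _
    · simp only [Real.norm_eq_abs, Real.abs_exp, hin]
      exact integrable_exp_mul_normSq_complexGaussian (by linarith)
  refine ⟨hi, ?_⟩
  rw [integral_prod _ hi]
  simp only [hin]
  rw [integral_exp_mul_normSq_complexGaussian (by linarith)]
  ring_nf

/-- The exponential Markov inequality for a sum of independent identically distributed terms. -/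
lemma measureReal_le_sum_le_of_integral_exp_le {ι X : Type*} [Fintype ι] [MeasurableSpace X]
    {μ : Measure X} [IsProbabilityMeasure μ] {h : X → ℝ} {b u : ℝ}
    (hi : Integrable (fun x => Real.exp (h x)) μ)
    (hb : ∫ x, Real.exp (h x) ∂μ ≤ Real.exp b) :
    (Measure.pi fun _ : ι => μ).real {y | u ≤ ∑ j, h (y j)} ≤
      Real.exp (Fintype.card ι * b - u) := by
  have hI : Integrable (fun y : ι → X => Real.exp (1 * ∑ j, h (y j)))
      (Measure.pi fun _ : ι => μ) := by
    simp only [one_mul, Real.exp_sum]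
    exact Integrable.fintype_prod fun _ => hi
  refine (measure_ge_le_exp_mul_mgf u zero_le_one hI).trans ?_
  have hm : mgf (fun y : ι → X => ∑ j, h (y j)) (Measure.pi fun _ : ι => μ) 1 =
      (∫ x, Real.exp (h x) ∂μ) ^ Fintype.card ι := by
    simp only [mgf, one_mul, Real.exp_sum]
    exact integral_fintype_prod_eq_pow (μ := μ) fun x => Real.exp (h x)
  rw [hm]
  calc _ ≤ Real.exp (-1 * u) * Real.exp b ^ Fintype.card ι := by
        gcongr
    _ = _ := by rw [← Real.exp_nat_mul, ← Real.exp_add]; ring_nf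

/-- Lets a family of Gaussian vectors be read as independent coordinate columns; both iterated
products are curryings of one product over pairs. -/
lemma measurePreserving_pi_swap {ι κ X : Type*} [Fintype ι] [Fintype κ] [MeasurableSpace X]
    (μ : Measure X) [IsProbabilityMeasure μ] :
    MeasurePreserving (fun (y : ι → κ → X) j i => y i j)
      (Measure.pi fun _ : ι => Measure.pi fun _ : κ => μ)
      (Measure.pi fun _ : κ => Measure.pi fun _ : ι => μ) := by
  refine ⟨by fun_prop, ?_⟩
  have h1 := Measure.infinitePi_map_curry (ι := ι) (κ := κ) (fun _ _ => μ)
  have h2 := Measure.infinitePi_map_curry (ι := κ) (κ := ι) (fun _ _ => μ)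
  have h3 := Measure.infinitePi_map_piCongrLeft (μ := fun _ : κ × ι => μ) (Equiv.prodComm ι κ)
  simp only [Measure.infinitePi_eq_pi] at h1 h2 h3
  rw [← h1, ← h2, ← h3, Measure.map_map (by fun_prop) (by fun_prop),
    Measure.map_map (by fun_prop) (by fun_prop)]
  congr 1

/-! ### Stability of Gram-Schmidt for almost orthonormal vectors. -/

section GramSchmidt

open InnerProductSpace

variable {E : Type*} [NormedAddCommGroup E] [InnerProductSpace ℂ E] {n : ℕ} {u : Fin n → E} {s : ℝ}

lemma norm_gramSchmidtNormed_le_one (u : Fin n → E) (i : Fin n) :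
    ‖gramSchmidtNormed ℂ u i‖ ≤ 1 := by
  rw [gramSchmidtNormed, norm_smul, norm_inv, RCLike.norm_ofReal, abs_norm]
  exact inv_mul_le_one

lemma gramSchmidt_eq_sub_sum_inner_gramSchmidtNormed (u : Fin n → E) (i : Fin n) :
    gramSchmidt ℂ u i = u i - ∑ l ∈ Finset.Iio i,
      inner ℂ (gramSchmidtNormed ℂ u l) (u i) • gramSchmidtNormed ℂ u l := by
  rw [gramSchmidt_def]
  congr 1
  refine Finset.sum_congr rfl fun l _ => ?_
  rw [Submodule.starProjection_singleton, gramSchmidtNormed, inner_smul_left, smul_smul]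
  congr 1
  simp
  ring

lemma norm_gramSchmidt_sub_le {i : Fin n} (hs : 0 ≤ s)
    (h : ∀ l < i, ‖inner ℂ (gramSchmidtNormed ℂ u l) (u i)‖ ≤ 2 * s) :
    ‖gramSchmidt ℂ u i - u i‖ ≤ 2 * (n * s) := by
  rw [gramSchmidt_eq_sub_sum_inner_gramSchmidtNormed, norm_sub_rev, sub_sub_cancel]
  calc _ ≤ ∑ l ∈ Finset.Iio i, 2 * s := by
        refine norm_sum_le_of_le _ fun l hl => ?_
        rw [norm_smul]
        exact (mul_le_of_le_one_right (norm_nonneg _) (norm_gramSchmidtNormed_le_one u l)).trans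
          (h l (Finset.mem_Iio.1 hl))
    _ ≤ n * (2 * s) := by
        rw [Finset.sum_const, nsmul_eq_mul, Fin.card_Iio]
        gcongr
        exact i.is_lt.le
    _ = _ := by ring

/-- Strong induction on `k`: earlier corrections contribute at most `n * (2 * s) ^ 2 ≤ s / 4`, and
the unnormalised vector has norm at least 7/8, so the quotient `(5 / 4 * s) / (7 / 8)` stays below
`2 * s`. -/
lemma norm_inner_gramSchmidtNormed_le (hs : 0 ≤ s) (hns : n * s ≤ 1 / 16)
    (hu : ∀ i, ‖u i‖ = 1) (h : ∀ i k, i ≠ k → ‖inner ℂ (u i) (u k)‖ ≤ s) (k : Fin n) :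
    ∀ i, k < i → ‖inner ℂ (gramSchmidtNormed ℂ u k) (u i)‖ ≤ 2 * s := by
  induction k using WellFoundedLT.induction with
  | ind k ih =>
    intro i hki
    have h1 : ‖gramSchmidt ℂ u k - u k‖ ≤ 2 * (n * s) :=
      norm_gramSchmidt_sub_le hs fun l hl => ih l hl k hl
    have h2 : 7 / 8 ≤ ‖gramSchmidt ℂ u k‖ := by
      have := norm_sub_norm_le (u k) (gramSchmidt ℂ u k)
      rw [norm_sub_rev, hu] at this
      linarith
    have h3 : ‖inner ℂ (gramSchmidt ℂ u k) (u i)‖ ≤ s + n * (2 * s * (2 * s)) := by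
      rw [gramSchmidt_eq_sub_sum_inner_gramSchmidtNormed, inner_sub_left, sum_inner]
      refine (norm_sub_le _ _).trans (add_le_add (h k i hki.ne) ?_)
      calc _ ≤ ∑ l ∈ Finset.Iio k, 2 * s * (2 * s) := by
            refine norm_sum_le_of_le _ fun l hl => ?_
            have hl' := Finset.mem_Iio.1 hl
            rw [inner_smul_left, norm_mul, RCLike.norm_conj]
            exact mul_le_mul (ih l hl' k hl') (ih l hl' i (hl'.trans hki)) (norm_nonneg _)
              (by positivity)
        _ ≤ n * (2 * s * (2 * s)) := by
            rw [Finset.sum_const, nsmul_eq_mul, Fin.card_Iio]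
            gcongr
            exact k.is_lt.le
    rw [gramSchmidtNormed, inner_smul_left, norm_mul, RCLike.norm_conj, norm_inv,
      RCLike.norm_ofReal, abs_norm, inv_mul_le_iff₀ (by linarith)]
    have h4 : n * (2 * s * (2 * s)) ≤ s / 4 := by nlinarith
    nlinarith

/-- Gram-Schmidt orthonormalisation moves almost orthogonal unit vectors only a little. -/
lemma norm_gramSchmidtNormed_sub_le (hs : 0 ≤ s) (hns : n * s ≤ 1 / 16)
    (hu : ∀ i, ‖u i‖ = 1) (h : ∀ i k, i ≠ k → ‖inner ℂ (u i) (u k)‖ ≤ s) (i : Fin n) :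
    ‖gramSchmidtNormed ℂ u i - u i‖ ≤ 4 * (n * s) := by
  have h1 : ‖gramSchmidt ℂ u i - u i‖ ≤ 2 * (n * s) := norm_gramSchmidt_sub_le hs fun l hl =>
    norm_inner_gramSchmidtNormed_le hs hns hu h l i hl
  have h2 : |‖gramSchmidt ℂ u i‖ - 1| ≤ 2 * (n * s) := by
    have := abs_norm_sub_norm_le (gramSchmidt ℂ u i) (u i)
    rw [hu] at this
    exact this.trans h1
  have hpos : 0 < ‖gramSchmidt ℂ u i‖ := by
    have := (abs_le.1 h2).1
    linarith
  have h3 : ‖gramSchmidtNormed ℂ u i - gramSchmidt ℂ u i‖ = |‖gramSchmidt ℂ u i‖ - 1| := by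
    have : gramSchmidtNormed ℂ u i - gramSchmidt ℂ u i =
        (((‖gramSchmidt ℂ u i‖⁻¹ - 1 : ℝ) : ℂ)) • gramSchmidt ℂ u i := by
      rw [gramSchmidtNormed]
      push_cast
      rw [sub_smul, one_smul]
      rfl
    rw [this, norm_smul, Complex.norm_real, Real.norm_eq_abs, ← abs_of_pos hpos, ← abs_mul,
      abs_of_pos hpos, sub_mul, inv_mul_cancel₀ hpos.ne', one_mul, abs_sub_comm]
  have := norm_sub_le_norm_sub_add_norm_sub (gramSchmidtNormed ℂ u i) (gramSchmidt ℂ u i) (u i)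
  linarith

/-- If vectors are almost orthonormal, then normalising them and applying the Gram-Schmidt process
moves them only a little. -/
lemma norm_gramSchmidtNormed_normalize_sub_le {z : Fin n → E} (hs : 0 ≤ s) (hns : n * s ≤ 1 / 32)
    (hz : ∀ i, |‖z i‖ ^ 2 - 1| ≤ s) (h : ∀ i k, i ≠ k → ‖inner ℂ (z i) (z k)‖ ≤ s) (i : Fin n) :
    ‖gramSchmidtNormed ℂ (fun k => ((‖z k‖⁻¹ : ℝ) : ℂ) • z k) i - z i‖ ≤ 9 * (n * s) := by
  have hn : (1 : ℝ) ≤ n := by exact_mod_cast i.pos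
  have hs1 : s ≤ 1 / 32 := by nlinarith
  have hpos (k : Fin n) : 0 < ‖z k‖ := by
    by_contra h0
    have h0 : ‖z k‖ = 0 := le_antisymm (not_lt.1 h0) (norm_nonneg _)
    have := hz k
    rw [h0] at this
    norm_num at this
    linarith
  have hu (k : Fin n) : ‖((‖z k‖⁻¹ : ℝ) : ℂ) • z k‖ = 1 := by
    rw [norm_smul, Complex.norm_real, norm_inv, norm_norm, inv_mul_cancel₀ (hpos k).ne']
  have hlow (k : Fin n) : |‖z k‖ - 1| ≤ s := by
    have h1 : |‖z k‖ ^ 2 - 1| = |‖z k‖ - 1| * (‖z k‖ + 1) := by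
      rw [show ‖z k‖ ^ 2 - 1 = (‖z k‖ - 1) * (‖z k‖ + 1) by ring, abs_mul,
        abs_of_pos (add_pos (hpos k) one_pos)]
    nlinarith [hz k, abs_nonneg (‖z k‖ - 1), hpos k]
  have hin (k l : Fin n) (hkl : k ≠ l) :
      ‖inner ℂ (((‖z k‖⁻¹ : ℝ) : ℂ) • z k) (((‖z l‖⁻¹ : ℝ) : ℂ) • z l)‖ ≤ 2 * s := by
    rw [inner_smul_left, inner_smul_right, norm_mul, norm_mul, RCLike.norm_conj,
      Complex.norm_real, Complex.norm_real, norm_inv, norm_inv, norm_norm, norm_norm,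
      inv_mul_le_iff₀ (hpos k), inv_mul_le_iff₀ (hpos l)]
    have h1 := (abs_le.1 (hlow k)).1
    have h2 := (abs_le.1 (hlow l)).1
    have h3 : 1 / 2 ≤ ‖z l‖ * ‖z k‖ := by nlinarith
    nlinarith [h k l hkl]
  have h1 := norm_gramSchmidtNormed_sub_le (u := fun k => ((‖z k‖⁻¹ : ℝ) : ℂ) • z k)
    (s := 2 * s) (by positivity) (by linarith) hu hin i
  have h2 : ‖((‖z i‖⁻¹ : ℝ) : ℂ) • z i - z i‖ ≤ s := by
    have : ((‖z i‖⁻¹ : ℝ) : ℂ) • z i - z i = ((‖z i‖⁻¹ - 1 : ℝ) : ℂ) • z i := by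
      push_cast
      rw [sub_smul, one_smul]
    rw [this, norm_smul, Complex.norm_real, Real.norm_eq_abs, ← abs_of_pos (hpos i), ← abs_mul,
      abs_of_pos (hpos i), sub_mul, inv_mul_cancel₀ (hpos i).ne', one_mul, abs_sub_comm]
    exact hlow i
  have h3 := norm_sub_le_norm_sub_add_norm_sub
    (gramSchmidtNormed ℂ (fun k => ((‖z k‖⁻¹ : ℝ) : ℂ) • z k) i) (((‖z i‖⁻¹ : ℝ) : ℂ) • z i) (z i)
  have h4 : s ≤ n * s := le_mul_of_one_le_left hs hn
  linarith

end GramSchmidt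

/-! ### Elementary inequalities and the Chernoff bound over coordinates. -/

lemma sum_abs_normSq_sub_normSq_le {ι : Type*} [Fintype ι] (w z : EuclideanSpace ℂ ι) :
    ∑ j, |‖w j‖ ^ 2 - ‖z j‖ ^ 2| ≤ ‖w - z‖ * (‖w‖ + ‖z‖) := by
  have key (v : EuclideanSpace ℂ ι) : ∑ j, ‖(w - z) j‖ * ‖v j‖ ≤ ‖w - z‖ * ‖v‖ := by
    rw [EuclideanSpace.norm_eq, EuclideanSpace.norm_eq]
    exact Real.sum_mul_le_sqrt_mul_sqrt _ _ _
  calc ∑ j, |‖w j‖ ^ 2 - ‖z j‖ ^ 2|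
      ≤ ∑ j, (‖(w - z) j‖ * ‖w j‖ + ‖(w - z) j‖ * ‖z j‖) := by
        refine Finset.sum_le_sum fun j _ => ?_
        rw [← mul_add, sq_sub_sq, abs_mul, abs_of_nonneg (by positivity), mul_comm]
        gcongr
        exact abs_norm_sub_norm_le _ _
    _ ≤ _ := by
        rw [Finset.sum_add_distrib, mul_add]
        exact add_le_add (key w) (key z)

lemma one_add_sum_le_prod_one_add_of_nonneg {ι : Type*} (s : Finset ι) {f : ι → ℝ}
    (hf : ∀ i, 0 ≤ f i) : 1 + ∑ i ∈ s, f i ≤ ∏ i ∈ s, (1 + f i) := by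
  classical
  induction s using Finset.induction_on with
  | empty => simp
  | insert a s ha ih =>
    rw [Finset.sum_insert ha, Finset.prod_insert ha]
    nlinarith [hf a, Finset.sum_nonneg fun i (_ : i ∈ s) => hf i]

/-- Trades `exp (-|x|)` for a cosine, so that a characteristic function controls a Laplace
transform. -/
lemma exp_neg_abs_le_one_sub_one_sub_cos (x : ℝ) :
    Real.exp (-|x|) ≤ 1 - (1 - Real.cos x) / 4 := by
  have h0 := abs_nonneg x
  have h1 : Real.exp (-|x|) ≤ 1 - |x| / (1 + |x|) := by
    rw [Real.exp_neg, one_sub_div (by positivity), add_sub_cancel_right, ← one_div]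
    gcongr
    linarith [Real.add_one_le_exp |x|]
  have h2 : (1 - Real.cos x) / 4 ≤ |x| / (1 + |x|) := by
    rw [le_div_iff₀ (by positivity)]
    rcases le_total |x| 2 with h | h
    · have := Real.one_sub_sq_div_two_le_cos (x := x)
      rw [← sq_abs] at this
      nlinarith [mul_nonneg h0 h0]
    · have := Real.neg_one_le_cos x
      nlinarith
  linarith

lemma measureReal_gaussianFamily_le {d m : ℕ} {h : (Fin m → ℝ × ℝ) → ℝ} {b u : ℝ}
    (hi : Integrable (fun x => Real.exp (h x)) (Measure.pi fun _ : Fin m => complexGaussian))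
    (hb : ∫ x, Real.exp (h x) ∂(Measure.pi fun _ : Fin m => complexGaussian) ≤ Real.exp b) :
    (gaussianFamily d m).real {y | u ≤ ∑ j, h fun i => y i j} ≤ Real.exp (d * b - u) := by
  have h1 := measureReal_le_sum_le_of_integral_exp_le (ι := Fin d) (u := u) hi hb
  rw [Fintype.card_fin] at h1
  refine le_trans ?_ h1
  have hmp := measurePreserving_pi_swap (ι := Fin m) (κ := Fin d) complexGaussian
  rw [← hmp.map_eq]
  -- The inequality for preimages holds for arbitrary sets, so the event need not be measurable.
  exact ENNReal.toReal_mono (measure_ne_top _ _)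
    (Measure.le_map_apply hmp.measurable.aemeasurable _)

/-! ### Lower tail of the ℓ¹ norm for Gaussian vectors. -/

section LowerTail

variable {m : ℕ} {θ : Fin m → ℝ}

/-- By independence the integral is `∏ (1 - 2 * θ i * I)⁻¹`, and the inverse of its squared modulus
is `∏ (1 + 4 * θ i ^ 2) ≥ 1 + 4 ≥ 2 ^ 2`. -/
lemma norm_integral_cexp_sum_mul_normSq_le (hθ : ∑ i, θ i ^ 2 = 1) :
    ‖∫ x : Fin m → ℝ × ℝ, Complex.exp ((∑ i, θ i * ((x i).1 ^ 2 + (x i).2 ^ 2) : ℝ) * Complex.I)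
      ∂(Measure.pi fun _ => complexGaussian)‖ ≤ 1 / 2 := by
  have h1 (x : Fin m → ℝ × ℝ) :
      Complex.exp ((∑ i, θ i * ((x i).1 ^ 2 + (x i).2 ^ 2) : ℝ) * Complex.I) =
      ∏ i, Complex.exp ((θ i * Complex.I) * (((x i).1 ^ 2 + (x i).2 ^ 2 : ℝ) : ℂ)) := by
    rw [← Complex.exp_sum, Complex.ofReal_sum, Finset.sum_mul]
    congr 1
    refine Finset.sum_congr rfl fun i _ => ?_
    push_cast
    ring
  simp only [h1]
  rw [integral_fintype_prod_eq_prod (μ := fun _ : Fin m => complexGaussian)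
    (fun i (x : ℝ × ℝ) => Complex.exp ((θ i * Complex.I) * ((x.1 ^ 2 + x.2 ^ 2 : ℝ) : ℂ)))]
  have h2 (i : Fin m) : ∫ x : ℝ × ℝ, Complex.exp ((θ i * Complex.I) *
      ((x.1 ^ 2 + x.2 ^ 2 : ℝ) : ℂ)) ∂complexGaussian = (1 - 2 * (θ i * Complex.I))⁻¹ :=
    integral_cexp_mul_normSq_complexGaussian (by simp)
  simp only [h2]
  rw [Finset.prod_inv_distrib, norm_inv, one_div]
  refine inv_anti₀ two_pos (le_of_sq_le_sq ?_ (norm_nonneg _))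
  rw [norm_prod, ← Finset.prod_pow]
  have h3 (i : Fin m) : ‖(1 - 2 * (θ i * Complex.I) : ℂ)‖ ^ 2 = 1 + 4 * θ i ^ 2 := by
    rw [Complex.sq_norm, Complex.normSq_apply]
    simp
    ring
  simp only [h3]
  have := one_add_sum_le_prod_one_add_of_nonneg Finset.univ
    (f := fun i => 4 * θ i ^ 2) fun i => by positivity
  rw [← Finset.mul_sum, hθ] at this
  linarith

lemma integrable_exp_neg_abs_sum_mul_normSq (θ : Fin m → ℝ) :
    Integrable (fun x : Fin m → ℝ × ℝ =>
      Real.exp (-|∑ i, θ i * ((x i).1 ^ 2 + (x i).2 ^ 2)|))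
      (Measure.pi fun _ => complexGaussian) := by
  refine Integrable.of_bound (Measurable.aestronglyMeasurable (by fun_prop)) 1
    (Filter.Eventually.of_forall fun x => ?_)
  rw [Real.norm_eq_abs, Real.abs_exp, Real.exp_le_one_iff]
  exact neg_nonpos.2 (abs_nonneg _)

/-- The cosine has mean at most 1/2, so the integral is at most `3/4 + 1/8 = 1 - 1/8`. -/
lemma integral_exp_neg_abs_sum_mul_normSq_le (hθ : ∑ i, θ i ^ 2 = 1) :
    ∫ x : Fin m → ℝ × ℝ, Real.exp (-|∑ i, θ i * ((x i).1 ^ 2 + (x i).2 ^ 2)|)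
      ∂(Measure.pi fun _ => complexGaussian) ≤ Real.exp (-(1 / 8)) := by
  set μ : Measure (Fin m → ℝ × ℝ) := Measure.pi fun _ => complexGaussian
  set Z : (Fin m → ℝ × ℝ) → ℝ := fun x => ∑ i, θ i * ((x i).1 ^ 2 + (x i).2 ^ 2) with hZ
  have hZm : Measurable Z := by fun_prop
  have hci : Integrable (fun x => Complex.exp (Z x * Complex.I)) μ := by
    refine Integrable.of_bound (Measurable.aestronglyMeasurable (by fun_prop)) 1
      (Filter.Eventually.of_forall fun x => ?_)
    rw [Complex.norm_exp_ofReal_mul_I]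
  have hre (x : Fin m → ℝ × ℝ) : Real.cos (Z x) = RCLike.re (Complex.exp (Z x * Complex.I)) := by
    exact (Complex.exp_ofReal_mul_I_re _).symm
  have hcosi : Integrable (fun x => Real.cos (Z x)) μ := by
    simp only [hre]
    exact hci.re
  have hcos : ∫ x, Real.cos (Z x) ∂μ ≤ 1 / 2 := by
    simp only [hre]
    rw [integral_re hci]
    exact (Complex.re_le_norm _).trans (norm_integral_cexp_sum_mul_normSq_le hθ)
  have hcosi' : Integrable (fun x => 3 / 4 + (1 / 4) * Real.cos (Z x)) μ :=
    (integrable_const _).add (hcosi.const_mul _)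
  calc ∫ x, Real.exp (-|Z x|) ∂μ ≤ ∫ x, (3 / 4 + (1 / 4) * Real.cos (Z x)) ∂μ := by
        refine integral_mono (integrable_exp_neg_abs_sum_mul_normSq θ) hcosi' fun x => ?_
        have := exp_neg_abs_le_one_sub_one_sub_cos (Z x)
        simp only
        linarith
    _ = 3 / 4 + (1 / 4) * ∫ x, Real.cos (Z x) ∂μ := by
        rw [integral_add (integrable_const _) (hcosi.const_mul _), integral_const_mul]
        simp
    _ ≤ -(1 / 8) + 1 := by linarith
    _ ≤ _ := Real.add_one_le_exp _

/-- A linear combination of the squared entries of Gaussian vectors has large `ℓ¹` norm, except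
with exponentially small probability. -/
lemma measureReal_sum_abs_le (d : ℕ) (hθ : ∑ i, θ i ^ 2 = 1) :
    (gaussianFamily d m).real
      {y | ∑ j, |∑ i, θ i * ((y i j).1 ^ 2 + (y i j).2 ^ 2)| ≤ d / 16} ≤
      Real.exp (-(d / 16)) := by
  have h := measureReal_gaussianFamily_le (d := d) (u := -(d / 16 : ℝ))
    (integrable_exp_neg_abs_sum_mul_normSq θ) (integral_exp_neg_abs_sum_mul_normSq_le hθ)
  have hset : {y : Fin m → Fin d → ℝ × ℝ |
      ∑ j, |∑ i, θ i * ((y i j).1 ^ 2 + (y i j).2 ^ 2)| ≤ d / 16} =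
      {y | -(d / 16 : ℝ) ≤ ∑ j, -|∑ i, θ i * ((y i j).1 ^ 2 + (y i j).2 ^ 2)|} := by
    ext y
    simp only [Set.mem_ofPred_eq, Finset.sum_neg_distrib, neg_le_neg_iff]
  rw [hset]
  refine h.trans (Real.exp_le_exp.2 (le_of_eq ?_))
  ring

end LowerTail

/-! ### Concentration of the Gram matrix. -/

section InnerProducts

variable {m : ℕ}

lemma measurePreserving_eval_pair {i k : Fin m} (hik : i ≠ k) :
    MeasurePreserving (fun x : Fin m → ℝ × ℝ => (x i, x k))
      (Measure.pi fun _ => complexGaussian) (complexGaussian.prod complexGaussian) := by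
  refine ⟨by fun_prop, ?_⟩
  have h := (iIndepFun_pi (μ := fun _ : Fin m => complexGaussian)
    (X := fun _ => (id : ℝ × ℝ → ℝ × ℝ)) fun _ => aemeasurable_id).indepFun hik
  simp only [id] at h
  rw [indepFun_iff_map_prod_eq_prod_map_map (measurable_pi_apply i).aemeasurable
    (measurable_pi_apply k).aemeasurable] at h
  rw [h]
  congr 1
  · exact (measurePreserving_eval (fun _ : Fin m => complexGaussian) i).map_eq
  · exact (measurePreserving_eval (fun _ : Fin m => complexGaussian) k).map_eq

/-- Tail bound for a bilinear form in two different vectors of a Gaussian family. -/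
lemma measureReal_le_sum_bilinear {d : ℕ} {i k : Fin m} (hik : i ≠ k) {u v : ℝ × ℝ → ℝ}
    (hu : Measurable u) (hv : Measurable v)
    (huv : ∀ x, u x ^ 2 + v x ^ 2 = x.1 ^ 2 + x.2 ^ 2) {s : ℝ} (hs : 0 < s) (hs1 : s ≤ 1) :
    (gaussianFamily d m).real
      {y | s * d ≤ ∑ j, (u (y i j) * (y k j).1 + v (y i j) * (y k j).2)} ≤
      Real.exp (-(s ^ 2 * d / 16)) := by
  have ht : (s / 8) ^ 2 ≤ 1 / 64 := by nlinarith
  -- The value `t = s / 8` minimises the Chernoff exponent `4 * t ^ 2 - t * s` per coordinate.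
  obtain ⟨hi, he⟩ := integrable_exp_bilinear_complexGaussian hu hv (t := s / 8) (by linarith) huv
  have hmp := measurePreserving_eval_pair hik
  have hi' := (hmp.integrable_comp hi.aestronglyMeasurable).2 hi
  have hb : ∫ x : Fin m → ℝ × ℝ, Real.exp (s / 8 * (u (x i) * (x k).1 + v (x i) * (x k).2))
      ∂(Measure.pi fun _ => complexGaussian) ≤ Real.exp (4 * (s / 8) ^ 2) := by
    have h1 := integral_map (μ := Measure.pi fun _ : Fin m => complexGaussian)
      hmp.measurable.aemeasurable (hmp.map_eq.symm ▸ hi.aestronglyMeasurable)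
    rw [hmp.map_eq, he] at h1
    rw [← h1]
    rw [inv_le_iff_one_le_mul₀ (by linarith)]
    nlinarith [Real.add_one_le_exp (4 * (s / 8) ^ 2), sq_nonneg (s / 8)]
  have h := measureReal_gaussianFamily_le (d := d) (u := s / 8 * (s * d)) hi' hb
  refine le_trans (measureReal_mono fun y hy => ?_) (h.trans (Real.exp_le_exp.2 (le_of_eq ?_)))
  · simp only [Set.mem_ofPred_eq] at hy ⊢
    rw [← Finset.mul_sum]
    gcongr
  · ring

/-- Tail bound for the squared norm of a vector of a Gaussian family; the sign `σ` distinguishes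
the upper and the lower tail. -/
lemma measureReal_le_sum_normSq_sub {d : ℕ} (i : Fin m) {s σ : ℝ} (hσ : σ = 1 ∨ σ = -1)
    (hs : 0 < s) (hs1 : s ≤ 1) :
    (gaussianFamily d m).real
      {y | s * d ≤ ∑ j, σ * ((y i j).1 ^ 2 + (y i j).2 ^ 2 - 2)} ≤
      Real.exp (-(s ^ 2 * d / 16)) := by
  set t : ℝ := σ * (s / 8) with htdef
  have hσ2 : σ ^ 2 = 1 := by rcases hσ with rfl | rfl <;> norm_num
  have ht2 : t ^ 2 = (s / 8) ^ 2 := by rw [htdef, mul_pow, hσ2, one_mul]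
  have ht : |t| ≤ 1 / 8 := by
    rw [← sq_le_sq₀ (abs_nonneg _) (by norm_num), sq_abs, ht2]
    nlinarith
  obtain ⟨ht1, ht3⟩ := abs_le.1 ht
  have hrw (x : ℝ × ℝ) : Real.exp (t * (x.1 ^ 2 + x.2 ^ 2 - 2)) =
      Real.exp (-2 * t) * Real.exp (t * (x.1 ^ 2 + x.2 ^ 2)) := by
    rw [← Real.exp_add]
    ring_nf
  have hi : Integrable (fun x : ℝ × ℝ => Real.exp (t * (x.1 ^ 2 + x.2 ^ 2 - 2)))
      complexGaussian := by
    simp only [hrw]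
    exact (integrable_exp_mul_normSq_complexGaussian (by linarith)).const_mul _
  have hmp := measurePreserving_eval (fun _ : Fin m => complexGaussian) i
  have hi' := (hmp.integrable_comp hi.aestronglyMeasurable).2 hi
  have hb : ∫ x : Fin m → ℝ × ℝ, Real.exp (t * ((x i).1 ^ 2 + (x i).2 ^ 2 - 2))
      ∂(Measure.pi fun _ => complexGaussian) ≤ Real.exp (4 * t ^ 2) := by
    have h1 := integral_map (μ := Measure.pi fun _ : Fin m => complexGaussian)
      hmp.measurable.aemeasurable (hmp.map_eq.symm ▸ hi.aestronglyMeasurable)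
    rw [hmp.map_eq] at h1
    simp only [Function.eval] at h1
    rw [← h1]
    simp only [hrw]
    rw [integral_const_mul, integral_exp_mul_normSq_complexGaussian (by linarith),
      ← div_eq_mul_inv, div_le_iff₀ (by linarith)]
    have h2 : Real.exp (4 * t ^ 2) = Real.exp (-2 * t) * Real.exp (2 * t + 4 * t ^ 2) := by
      rw [← Real.exp_add]
      ring_nf
    rw [h2, mul_assoc]
    refine le_mul_of_one_le_right (Real.exp_pos _).le ?_
    -- The linear bound on the exponential gives `(1 + 2t + 4t²)(1 - 2t) = 1 - 8t³`, enough only for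
    -- `t ≤ 0`; positive `t` needs the quadratic term.
    rcases le_total t 0 with h3 | h3
    · have h4 := Real.add_one_le_exp (2 * t + 4 * t ^ 2)
      nlinarith [mul_nonneg (neg_nonneg.2 h3) (sq_nonneg t)]
    · have h4 := Real.quadratic_le_exp_of_nonneg (x := 2 * t + 4 * t ^ 2) (by positivity)
      have h5 : 1 + 2 * t + 6 * t ^ 2 ≤ Real.exp (2 * t + 4 * t ^ 2) := by
        nlinarith [pow_nonneg h3 3, pow_nonneg h3 4]
      nlinarith [mul_nonneg (sq_nonneg t) (sub_nonneg.2 ht3)]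
  have h := measureReal_gaussianFamily_le (d := d) (u := s / 8 * (s * d)) hi' hb
  refine le_trans (measureReal_mono fun y hy => ?_) (h.trans (Real.exp_le_exp.2 (le_of_eq ?_)))
  · simp only [Set.mem_ofPred_eq, Function.eval] at hy ⊢
    rw [← Finset.mul_sum] at hy ⊢
    rw [htdef, mul_comm σ, mul_assoc]
    gcongr
  · rw [ht2]
    ring

end InnerProducts

lemma normSq_toComplexVector_apply {d : ℕ} (a : Fin d → ℝ × ℝ) (j : Fin d) :
    ‖toComplexVector a j‖ ^ 2 = (a j).1 ^ 2 + (a j).2 ^ 2 := by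
  rw [Complex.sq_norm, Complex.normSq_apply]
  simp [toComplexVector]
  ring

lemma inner_toComplexVector_re {d : ℕ} (a b : Fin d → ℝ × ℝ) :
    (inner ℂ (toComplexVector a) (toComplexVector b)).re =
      ∑ j, ((a j).1 * (b j).1 + (a j).2 * (b j).2) := by
  rw [PiLp.inner_apply, Complex.re_sum]
  refine Finset.sum_congr rfl fun j _ => ?_
  simp [toComplexVector]
  ring

lemma inner_toComplexVector_im {d : ℕ} (a b : Fin d → ℝ × ℝ) :
    (inner ℂ (toComplexVector a) (toComplexVector b)).im =
      ∑ j, (-(a j).2 * (b j).1 + (a j).1 * (b j).2) := by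
  rw [PiLp.inner_apply, Complex.im_sum]
  refine Finset.sum_congr rfl fun j _ => ?_
  simp [toComplexVector]
  ring

/-- A Gaussian family in `ℂ ^ d`, scaled by `1 / √(2d)`, has Gram matrix close to the identity. -/
lemma measureReal_le_norm_inner_sub {d m : ℕ} (i k : Fin m) {s : ℝ} (hs : 0 < s) (hs1 : s ≤ 1) :
    (gaussianFamily d m).real {y | 2 * d * s <
      ‖inner ℂ (toComplexVector (y i)) (toComplexVector (y k)) - if i = k then 2 * (d : ℂ) else 0‖}
      ≤ 4 * Real.exp (-(s ^ 2 * d / 16)) := by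
  have hexp := (Real.exp_pos (-(s ^ 2 * d / 16))).le
  rcases eq_or_ne i k with rfl | hik
  · have h1 := measureReal_le_sum_normSq_sub (d := d) i (σ := 1) (Or.inl rfl) hs hs1
    have h2 := measureReal_le_sum_normSq_sub (d := d) i (σ := -1) (Or.inr rfl) hs hs1
    refine (measureReal_mono fun y hy => ?_).trans
      ((measureReal_union_le _ _).trans ((add_le_add h1 h2).trans (by linarith)))
    have h3 : inner ℂ (toComplexVector (y i)) (toComplexVector (y i)) - 2 * (d : ℂ) =
        ((∑ j, ((y i j).1 ^ 2 + (y i j).2 ^ 2 - 2) : ℝ) : ℂ) := by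
      apply Complex.ext
      · rw [Complex.sub_re, inner_toComplexVector_re, Complex.ofReal_re, Finset.sum_sub_distrib]
        simp [sq]
        ring
      · rw [Complex.sub_im, inner_toComplexVector_im, Complex.ofReal_im]
        simp only [Complex.mul_im, Complex.natCast_re, Complex.natCast_im, Complex.re_ofNat,
          Complex.im_ofNat, mul_zero, zero_mul, add_zero, sub_zero]
        exact Finset.sum_eq_zero fun j _ => by ring
    simp only [Set.mem_ofPred_eq, if_true, h3, Complex.norm_real, Real.norm_eq_abs] at hy
    -- The factor 2 is needed only off the diagonal, where it is split between real and imaginary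
    -- part.
    have h4 : s * d < |∑ j, ((y i j).1 ^ 2 + (y i j).2 ^ 2 - 2)| := by
      nlinarith [mul_nonneg hs.le (Nat.cast_nonneg (α := ℝ) d)]
    simp only [Set.mem_union, Set.mem_ofPred_eq, ← Finset.mul_sum]
    rcases lt_abs.1 h4 with h5 | h5
    · left; linarith
    · right; linarith
  · have hb {u v : ℝ × ℝ → ℝ} (hu : Measurable u) (hv : Measurable v)
        (huv : ∀ x, u x ^ 2 + v x ^ 2 = x.1 ^ 2 + x.2 ^ 2) :=
      measureReal_le_sum_bilinear (d := d) hik hu hv huv hs hs1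
    have h1 := hb (u := fun x => x.1) (v := fun x => x.2) (by fun_prop) (by fun_prop)
      fun x => by ring
    have h2 := hb (u := fun x => -x.1) (v := fun x => -x.2) (by fun_prop) (by fun_prop)
      fun x => by ring
    have h3 := hb (u := fun x => -x.2) (v := fun x => x.1) (by fun_prop) (by fun_prop)
      fun x => by ring
    have h4 := hb (u := fun x => x.2) (v := fun x => -x.1) (by fun_prop) (by fun_prop)
      fun x => by ring
    refine (measureReal_mono fun y hy => ?_).trans ((measureReal_union_le _ _).trans
      ((add_le_add ((measureReal_union_le _ _).trans (add_le_add h1 h2))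
        ((measureReal_union_le _ _).trans (add_le_add h3 h4))).trans (by linarith)))
    simp only [Set.mem_ofPred_eq, if_neg hik, sub_zero] at hy
    have h5 := hy.trans_le (Complex.norm_le_abs_re_add_abs_im _)
    rw [inner_toComplexVector_re, inner_toComplexVector_im] at h5
    have h6 : ∑ j, (-(y i j).1 * (y k j).1 + -(y i j).2 * (y k j).2) =
        -∑ j, ((y i j).1 * (y k j).1 + (y i j).2 * (y k j).2) := by
      rw [← Finset.sum_neg_distrib]
      exact Finset.sum_congr rfl fun j _ => by ring
    have h7 : ∑ j, ((y i j).2 * (y k j).1 + -(y i j).1 * (y k j).2) =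
        -∑ j, (-(y i j).2 * (y k j).1 + (y i j).1 * (y k j).2) := by
      rw [← Finset.sum_neg_distrib]
      exact Finset.sum_congr rfl fun j _ => by ring
    simp only [Set.mem_union, Set.mem_ofPred_eq]
    rw [h6, h7]
    have h8 : s * d < |∑ j, ((y i j).1 * (y k j).1 + (y i j).2 * (y k j).2)| ∨
        s * d < |∑ j, (-(y i j).2 * (y k j).1 + (y i j).1 * (y k j).2)| := by
      by_contra! h
      linarith [h.1, h.2]
    rcases h8 with h | h
    · exact Or.inl ((lt_abs.1 h).imp le_of_lt le_of_lt)
    · exact Or.inr ((lt_abs.1 h).imp le_of_lt le_of_lt)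

/-! ### Transfer from Gaussian to orthonormal families. -/

section Perturbation

variable {d n : ℕ}

lemma norm_orthonormalize_sub_le (hd : 0 < d) {y : Fin n → Fin d → ℝ × ℝ} {s : ℝ} (hs : 0 ≤ s)
    (hns : n * s ≤ 1 / 32)
    (h : ∀ i k, ‖inner ℂ (toComplexVector (y i)) (toComplexVector (y k)) -
      if i = k then 2 * (d : ℂ) else 0‖ ≤ 2 * d * s) (i : Fin n) :
    ‖orthonormalize y i - (((√(2 * d))⁻¹ : ℝ) : ℂ) • toComplexVector (y i)‖ ≤ 9 * (n * s) ∧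
      ‖(((√(2 * d))⁻¹ : ℝ) : ℂ) • toComplexVector (y i)‖ ≤ 2 := by
  have hd' : (0 : ℝ) < 2 * d := by positivity
  set c : ℝ := (√(2 * d))⁻¹ with hc
  have hc0 : 0 < c := by positivity
  have hc2 : c * c = (2 * (d : ℝ))⁻¹ := by
    rw [hc, ← mul_inv, Real.mul_self_sqrt hd'.le]
  set z : Fin n → EuclideanSpace ℂ (Fin d) := fun k => (c : ℂ) • toComplexVector (y k) with hz
  have hinner (i k : Fin n) : ‖inner ℂ (z i) (z k) - if i = k then 1 else 0‖ ≤ s := by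
    have h1 : inner ℂ (z i) (z k) - (if i = k then 1 else 0) = (((2 * (d : ℝ))⁻¹ : ℝ) : ℂ) *
        (inner ℂ (toComplexVector (y i)) (toComplexVector (y k)) -
          if i = k then 2 * (d : ℂ) else 0) := by
      simp only [hz]
      rw [inner_smul_left, inner_smul_right, Complex.conj_ofReal, ← mul_assoc,
        ← Complex.ofReal_mul, hc2, mul_sub]
      congr 1
      split_ifs
      · have : (d : ℂ) ≠ 0 := by exact_mod_cast hd.ne'
        push_cast
        field_simp
      · simp
    rw [h1, norm_mul, Complex.norm_real, Real.norm_eq_abs, abs_of_pos (inv_pos.2 hd'),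
      inv_mul_le_iff₀ hd']
    exact h i k
  have hsq (i : Fin n) : |‖z i‖ ^ 2 - 1| ≤ s := by
    have h1 := hinner i i
    rw [if_pos rfl, inner_self_eq_norm_sq_to_K] at h1
    rw [← Real.norm_eq_abs, ← Complex.norm_real]
    push_cast
    exact h1
  -- The positive scaling by `c` cancels on normalisation.
  have hort : orthonormalize y =
      InnerProductSpace.gramSchmidtNormed ℂ fun k => ((‖z k‖⁻¹ : ℝ) : ℂ) • z k := by
    unfold orthonormalize
    congr 1
    funext k
    simp only [hz, normalizedVector]
    rw [norm_smul, Complex.norm_real, Real.norm_eq_abs, abs_of_pos hc0, smul_smul,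
      ← Complex.ofReal_mul]
    congr 2
    field_simp
  rw [hort]
  refine ⟨norm_gramSchmidtNormed_normalize_sub_le hs hns hsq (fun i k hik => ?_) i, ?_⟩
  · simpa [hik] using hinner i k
  · have h1 := (abs_le.1 (hsq i)).2
    have h2 : (1 : ℝ) ≤ n := by exact_mod_cast i.pos
    have h3 : ‖z i‖ ^ 2 ≤ 2 ^ 2 := by nlinarith
    exact le_of_sq_le_sq h3 two_pos.le

/-- After scaling, the Gaussian term exceeds `(d / 16) / (2 * d) = 1 / 32`. Each vector of squared
entries moves by at most `9 * (n * s) * (1 + 2)` in ℓ¹, and Cauchy-Schwarz gives `∑ |θ i| ≤ √n`; the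
error thus uses up at most half of 1/32. -/
lemma sum_abs_sum_mul_normSq_orthonormalize_ge (hd : 0 < d) {y : Fin n → Fin d → ℝ × ℝ}
    {θ : Fin n → ℝ} (hθ : ∑ i, θ i ^ 2 = 1) {s : ℝ} (hs : 0 ≤ s)
    (hns : 27 * (n * s) * √n ≤ 1 / 64)
    (h0 : (d : ℝ) / 16 < ∑ j, |∑ i, θ i * ((y i j).1 ^ 2 + (y i j).2 ^ 2)|)
    (h : ∀ i k, ‖inner ℂ (toComplexVector (y i)) (toComplexVector (y k)) -
      if i = k then 2 * (d : ℂ) else 0‖ ≤ 2 * d * s) :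
    1 / 64 ≤ ∑ j, |∑ i, θ i * ‖orthonormalize y i j‖ ^ 2| := by
  have hd' : (0 : ℝ) < 2 * d := by positivity
  have hn : 1 ≤ (n : ℝ) := by
    rcases Nat.eq_zero_or_pos n with rfl | hn
    · simp at hθ
    · exact_mod_cast hn
  have hns' : n * s ≤ 1 / 32 := by
    have h1 : 1 ≤ √(n : ℝ) := Real.one_le_sqrt.2 hn
    have h2 : 0 ≤ n * s := by positivity
    nlinarith
  have hw := norm_orthonormalize_sub_le hd hs hns' h
  set z : Fin n → EuclideanSpace ℂ (Fin d) :=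
    fun k => (((√(2 * d))⁻¹ : ℝ) : ℂ) • toComplexVector (y k) with hz
  set w := orthonormalize y
  have hzj (i : Fin n) (j : Fin d) :
      ‖z i j‖ ^ 2 = (2 * (d : ℝ))⁻¹ * ((y i j).1 ^ 2 + (y i j).2 ^ 2) := by
    simp only [hz, PiLp.smul_apply]
    rw [norm_smul, Complex.norm_real, mul_pow, normSq_toComplexVector_apply, Real.norm_eq_abs,
      sq_abs, inv_pow, Real.sq_sqrt hd'.le]
  have hmain : 1 / 32 < ∑ j, |∑ i, θ i * ‖z i j‖ ^ 2| := by
    have h1 : ∑ j, |∑ i, θ i * ‖z i j‖ ^ 2| =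
        (2 * (d : ℝ))⁻¹ * ∑ j, |∑ i, θ i * ((y i j).1 ^ 2 + (y i j).2 ^ 2)| := by
      rw [Finset.mul_sum]
      refine Finset.sum_congr rfl fun j _ => ?_
      rw [← abs_of_pos (inv_pos.2 hd'), ← abs_mul, Finset.mul_sum]
      congr 1
      refine Finset.sum_congr rfl fun i _ => ?_
      rw [hzj]
      ring
    rw [h1, lt_inv_mul_iff₀ hd']
    linarith
  have herr : ∑ j, |∑ i, θ i * ‖w i j‖ ^ 2 - ∑ i, θ i * ‖z i j‖ ^ 2| ≤ 27 * (n * s) * √n := by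
    calc _ ≤ ∑ j, ∑ i, |θ i| * |‖w i j‖ ^ 2 - ‖z i j‖ ^ 2| := by
          refine Finset.sum_le_sum fun j _ => ?_
          rw [← Finset.sum_sub_distrib]
          refine (Finset.abs_sum_le_sum_abs _ _).trans (Finset.sum_le_sum fun i _ => ?_)
          rw [← mul_sub, abs_mul]
      _ = ∑ i, |θ i| * ∑ j, |‖w i j‖ ^ 2 - ‖z i j‖ ^ 2| := by
          rw [Finset.sum_comm]
          simp only [Finset.mul_sum]
      _ ≤ ∑ i, |θ i| * (27 * (n * s)) := by
          refine Finset.sum_le_sum fun i _ => ?_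
          gcongr
          refine (sum_abs_normSq_sub_normSq_le (w i) (z i)).trans ?_
          obtain ⟨h1, h2⟩ := hw i
          have h3 : ‖w i‖ ≤ 1 := norm_gramSchmidtNormed_le_one _ i
          calc _ ≤ 9 * (n * s) * (1 + 2) := by gcongr
            _ = _ := by ring
      _ = 27 * (n * s) * ∑ i, 1 * |θ i| := by
          simp only [one_mul]
          rw [← Finset.sum_mul, mul_comm]
      _ ≤ 27 * (n * s) * (√(∑ i : Fin n, 1 ^ 2) * √(∑ i, |θ i| ^ 2)) := by
          gcongr
          exact Real.sum_mul_le_sqrt_mul_sqrt _ _ _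
      _ = _ := by
          simp only [sq_abs, hθ]
          simp
  have htri : ∑ j, |∑ i, θ i * ‖z i j‖ ^ 2| ≤ ∑ j, |∑ i, θ i * ‖w i j‖ ^ 2| +
      ∑ j, |∑ i, θ i * ‖w i j‖ ^ 2 - ∑ i, θ i * ‖z i j‖ ^ 2| := by
    rw [← Finset.sum_add_distrib]
    refine Finset.sum_le_sum fun j _ => ?_
    have := abs_sub_abs_le_abs_sub (∑ i, θ i * ‖z i j‖ ^ 2) (∑ i, θ i * ‖w i j‖ ^ 2)
    rw [abs_sub_comm] at this
    linarith
  linarith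

/-- A normalised linear combination of the squared entries of a random orthonormal family has
`ℓ¹` norm bounded below, except with small probability. -/
lemma measureReal_sum_abs_orthonormalize_lt (hd : 0 < d) {θ : Fin n → ℝ}
    (hθ : ∑ i, θ i ^ 2 = 1) {s : ℝ} (hs : 0 < s) (hs1 : s ≤ 1)
    (hns : 27 * (n * s) * √n ≤ 1 / 64) :
    (gaussianFamily d n).real {y | ∑ j, |∑ i, θ i * ‖orthonormalize y i j‖ ^ 2| < 1 / 64} ≤
      (1 + 4 * (n : ℝ) ^ 2) * Real.exp (-(s ^ 2 * d / 16)) := by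
  have hB := measureReal_sum_abs_le d hθ
  have hB' : Real.exp (-((d : ℝ) / 16)) ≤ Real.exp (-(s ^ 2 * d / 16)) := by
    rw [Real.exp_le_exp, neg_le_neg_iff]
    have : s ^ 2 ≤ 1 := pow_le_one₀ hs.le hs1
    have : s ^ 2 * d ≤ 1 * d := by gcongr
    linarith
  set D : Fin n × Fin n → Set (Fin n → Fin d → ℝ × ℝ) := fun p => {y | 2 * d * s <
      ‖inner ℂ (toComplexVector (y p.1)) (toComplexVector (y p.2)) -
        if p.1 = p.2 then 2 * (d : ℂ) else 0‖} with hD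
  have hU : (gaussianFamily d n).real (⋃ p, D p) ≤
      4 * (n : ℝ) ^ 2 * Real.exp (-(s ^ 2 * d / 16)) := by
    refine (measureReal_iUnion_fintype_le D).trans ?_
    calc _ ≤ ∑ _p : Fin n × Fin n, 4 * Real.exp (-(s ^ 2 * d / 16)) :=
          Finset.sum_le_sum fun p _ => measureReal_le_norm_inner_sub p.1 p.2 hs hs1
      _ = _ := by
          simp
          ring
  refine (measureReal_mono fun y hy => ?_).trans ((measureReal_union_le _ _).trans
    ((add_le_add (hB.trans hB') hU).trans (le_of_eq (by ring))))
  by_contra hcon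
  simp only [hD, Set.mem_union, Set.mem_iUnion, Set.mem_ofPred_eq, not_or, not_exists, not_lt,
    not_le, Prod.forall] at hcon hy
  exact absurd hy (not_lt.2
    (sum_abs_sum_mul_normSq_orthonormalize_ge hd hθ hs.le hns hcon.1 hcon.2))

end Perturbation

/-! ### The coefficients of `S - T`. -/

section Weights

variable {d p q r : ℕ}

/-- The coefficients of the squared entries in the difference of the two distributions. -/
noncomputable def weight (p q r : ℕ) : Fin (p + q + r) → ℝ :=
  Fin.append (Fin.append (fun _ => 1 / ((p : ℝ) + r)) fun _ => -(1 / ((q : ℝ) + r)))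
    fun _ => 1 / ((p : ℝ) + r) - 1 / ((q : ℝ) + r)

lemma distS_sub_distT (w : Fin (p + q + r) → EuclideanSpace ℂ (Fin d)) (j : Fin d) :
    distS w j - distT w j = ∑ i, weight p q r i * ‖w i j‖ ^ 2 := by
  simp only [distS, distT, groupA, groupB, groupC, weight, Fin.sum_univ_add, Fin.append_left,
    Fin.append_right, ← Finset.mul_sum]
  ring

/-- Drop the nonnegative contribution of the shared vectors and use `(a + b) ^ 2 / 4 ≤ a ^ 2 + b ^
2`. -/
lemma le_sqrt_sum_weight_sq (p q r : ℕ) :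
    1 / 2 * (√(p : ℝ) / ((p : ℝ) + r) + √(q : ℝ) / ((q : ℝ) + r)) ≤
      √(∑ i, weight p q r i ^ 2) := by
  refine Real.le_sqrt_of_sq_le ?_
  have h1 : ∑ i, weight p q r i ^ 2 = p * (1 / ((p : ℝ) + r)) ^ 2 + q * (1 / ((q : ℝ) + r)) ^ 2 +
      r * (1 / ((p : ℝ) + r) - 1 / ((q : ℝ) + r)) ^ 2 := by
    simp [weight, Fin.sum_univ_add, Fin.append_left, Fin.append_right]
  have h2 (a b : ℕ) : (√(a : ℝ) / ((a : ℝ) + b)) ^ 2 = a * (1 / ((a : ℝ) + b)) ^ 2 := by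
    rw [div_pow, Real.sq_sqrt (Nat.cast_nonneg a), one_div_pow, mul_one_div]
  have h3 : 0 ≤ (r : ℝ) * (1 / ((p : ℝ) + r) - 1 / ((q : ℝ) + r)) ^ 2 := by positivity
  rw [h1, ← h2, ← h2]
  nlinarith [sq_nonneg (√(p : ℝ) / ((p : ℝ) + r) - √(q : ℝ) / ((q : ℝ) + r)),
    sq_nonneg (√(p : ℝ) / ((p : ℝ) + r)), sq_nonneg (√(q : ℝ) / ((q : ℝ) + r))]

/-- Apply the normalised bound to the weights divided by their ℓ² norm, which is nonzero because `p
+ q > 0`; the constant is `1 / 64 * (1 / 2)`. -/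
lemma measureReal_orthonormalize_distS_distT_lt (hd : 0 < d) (hpq : 0 < p + q) (hp : 0 < p + r)
    (hq : 0 < q + r) {s : ℝ} (hs : 0 < s) (hs1 : s ≤ 1)
    (hns : 27 * ((p + q + r : ℕ) * s) * √(p + q + r : ℕ) ≤ 1 / 64) :
    (gaussianFamily d (p + q + r)).real {y | ∑ j, |distS (orthonormalize y) j -
      distT (orthonormalize y) j| <
        1 / 128 * (√(p : ℝ) / ((p : ℝ) + r) + √(q : ℝ) / ((q : ℝ) + r))} ≤
      (1 + 4 * ((p + q + r : ℕ) : ℝ) ^ 2) * Real.exp (-(s ^ 2 * d / 16)) := by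
  set L : ℝ := √(∑ i, weight p q r i ^ 2) with hL
  have hle := le_sqrt_sum_weight_sq p q r
  have hL0 : 0 < L := by
    refine lt_of_lt_of_le ?_ hle
    have hp' : (0 : ℝ) < (p : ℝ) + r := by exact_mod_cast hp
    have hq' : (0 : ℝ) < (q : ℝ) + r := by exact_mod_cast hq
    rcases Nat.eq_zero_or_pos p with rfl | h
    · have : 0 < q := by omega
      positivity
    · positivity
  have hθ : ∑ i, (L⁻¹ * weight p q r i) ^ 2 = 1 := by
    simp only [mul_pow]
    rw [← Finset.mul_sum, ← Real.sq_sqrt (Finset.sum_nonneg fun i _ => sq_nonneg _), ← hL,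
      ← mul_pow, inv_mul_cancel₀ hL0.ne', one_pow]
  refine (measureReal_mono fun y hy => ?_).trans
    (measureReal_sum_abs_orthonormalize_lt hd hθ hs hs1 hns)
  simp only [Set.mem_ofPred_eq, distS_sub_distT] at hy ⊢
  have h1 (j : Fin d) : |∑ i, L⁻¹ * weight p q r i * ‖orthonormalize y i j‖ ^ 2| =
      L⁻¹ * |∑ i, weight p q r i * ‖orthonormalize y i j‖ ^ 2| := by
    rw [← abs_of_pos (inv_pos.2 hL0), ← abs_mul, Finset.mul_sum]
    simp only [mul_assoc, abs_of_pos (inv_pos.2 hL0)]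
  simp only [h1]
  rw [← Finset.mul_sum, inv_mul_lt_iff₀ hL0]
  linarith

end Weights

/-! ### Choice of constants and conclusion. -/

/-- The logarithm supplies a factor `n ^ (-8)`, which absorbs the union-bound count `1 + 4 * n ^ 2`
once `n ≥ 2`. -/
lemma five_mul_exp_le_exp_neg {n : ℕ} (hn : 2 ≤ n) {α : ℝ} (hα : 0 ≤ α) :
    (1 + 4 * (n : ℝ) ^ 2) * Real.exp (-(4 * (α + 2 * Real.log n))) ≤ Real.exp (-α) := by
  have hn' : (2 : ℝ) ≤ n := by exact_mod_cast hn
  have hn0 : (0 : ℝ) < n := by linarith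
  have h1 : Real.exp (-(4 * (α + 2 * Real.log n))) =
      Real.exp (-(4 * α)) * ((n : ℝ) ^ 8)⁻¹ := by
    have : -(4 * (α + 2 * Real.log n)) = -(4 * α) + -((8 : ℕ) * Real.log n) := by
      push_cast
      ring
    rw [this, Real.exp_add, Real.exp_neg ((8 : ℕ) * Real.log n), Real.exp_nat_mul,
      Real.exp_log hn0]
  have h2 : (1 + 4 * (n : ℝ) ^ 2) * ((n : ℝ) ^ 8)⁻¹ ≤ 1 := by
    rw [← div_eq_mul_inv, div_le_one (by positivity)]
    have h3 : (2 : ℝ) ^ 2 ≤ (n : ℝ) ^ 2 := by gcongr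
    have h4 : (2 : ℝ) ^ 6 ≤ (n : ℝ) ^ 6 := by gcongr
    have h5 : (n : ℝ) ^ 8 = (n : ℝ) ^ 6 * (n : ℝ) ^ 2 := by ring
    rw [h5]
    nlinarith
  calc _ = Real.exp (-(4 * α)) * ((1 + 4 * (n : ℝ) ^ 2) * ((n : ℝ) ^ 8)⁻¹) := by
        rw [h1]
        ring
    _ ≤ Real.exp (-(4 * α)) := mul_le_of_le_one_right (Real.exp_pos _).le h2
    _ ≤ _ := Real.exp_le_exp.2 (by linarith)

theorem mainTheorem7 :
    ∃ δ : ℕ → ℝ,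
      (∃ c₁ : ℝ, 0 < c₁ ∧ ∃ c₂ : ℝ, 0 < c₂ ∧ ∀ n : ℕ, 1 ≤ n →
        c₁ * (n : ℝ) ^ (-(3 / 2) : ℝ) ≤ δ n ∧ δ n ≤ c₂ * (n : ℝ) ^ (-(3 / 2) : ℝ)) ∧
      ∀ α₀ : ℝ, 0 < α₀ → ∃ κ : ℝ, 0 < κ ∧ ∃ η : ℝ, 0 < η ∧
        ∀ p q r d : ℕ, 0 < p + r → 0 < q + r → p + q + r ≤ d →
          ∀ α : ℝ, α = (d : ℝ) * δ (p + q + r) ^ 2 - 2 * Real.log ((p + q + r : ℕ) : ℝ) →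
            α₀ ≤ α →
            1 - Real.exp (-(κ * α)) ≤
              (randomOrthonormal d (p + q + r)).real
                {w | η * (√(p : ℝ) / ((p : ℝ) + r) + √(q : ℝ) / ((q : ℝ) + r)) ≤
                  ∑ j, |distS w j - distT w j|} := by
  refine ⟨fun n => 1 / 16000 * (n : ℝ) ^ (-(3 / 2) : ℝ), ⟨1 / 16000, by norm_num, 1 / 16000,
    by norm_num, fun n _ => ⟨le_rfl, le_rfl⟩⟩, fun α₀ hα₀ => ⟨1, one_pos, 1 / 128, by norm_num, ?_⟩⟩
  intro p q r d hp hq hd α hα hle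
  rw [one_mul]
  have hα0 : 0 < α := hα₀.trans_le hle
  -- If `p = q = 0` the required lower bound is 0. Otherwise `n ≥ 2`, since `p + r` and `q + r` are
  -- positive.
  rcases Nat.eq_zero_or_pos (p + q) with hpq | hpq
  · obtain ⟨rfl, rfl⟩ : p = 0 ∧ q = 0 := by omega
    have huniv : {w : Fin (0 + 0 + r) → EuclideanSpace ℂ (Fin d) |
        1 / 128 * (√((0 : ℕ) : ℝ) / (((0 : ℕ) : ℝ) + r) + √((0 : ℕ) : ℝ) / (((0 : ℕ) : ℝ) + r)) ≤
          ∑ j, |distS w j - distT w j|} = Set.univ := by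
      refine Set.eq_univ_of_forall fun w => ?_
      simp only [Set.mem_ofPred_eq, Nat.cast_zero, Real.sqrt_zero, zero_div, add_zero, mul_zero]
      exact Finset.sum_nonneg fun j _ => abs_nonneg _
    rw [huniv, probReal_univ]
    linarith [Real.exp_pos (-α)]
  · have hn2 : 2 ≤ p + q + r := by omega
    set n := p + q + r with hn
    have hn1 : (1 : ℝ) ≤ n := by exact_mod_cast (by omega : 1 ≤ n)
    have hn0 : (0 : ℝ) < n := by linarith
    set P : ℝ := (n : ℝ) ^ (-(3 / 2) : ℝ) with hP
    have hP0 : 0 < P := Real.rpow_pos_of_pos hn0 _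
    have hP1 : P ≤ 1 := Real.rpow_le_one_of_one_le_of_nonpos hn1 (by norm_num)
    have hPn : n * P * √(n : ℝ) = 1 := by
      rw [Real.sqrt_eq_rpow, hP]
      nth_rw 1 [← Real.rpow_one (n : ℝ)]
      rw [← Real.rpow_add hn0, ← Real.rpow_add hn0]
      norm_num
    -- The choice of `s` works as `27 / 2000 ≤ 1 / 64`. The constant in `δ` is then set by `16000 ^
    -- 2 = 4 * 16 * 2000 ^ 2`, making the exponent exactly `4 * d * δ n ^ 2`.
    have hbad := measureReal_orthonormalize_distS_distT_lt (d := d) (s := P / 2000) (by omega) hpq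
      hp hq (by positivity) (by linarith) (by
        rw [← hn]
        have : 27 * (n * (P / 2000)) * √(n : ℝ) = 27 / 2000 * (n * P * √(n : ℝ)) := by ring
        rw [this, hPn]
        norm_num)
    change (gaussianFamily d n).real _ ≤ (1 + 4 * (n : ℝ) ^ 2) * _ at hbad
    have hexp : (P / 2000) ^ 2 * d / 16 = 4 * (α + 2 * Real.log n) := by
      rw [hα]
      ring
    rw [hexp] at hbad
    have hbad' := hbad.trans (five_mul_exp_le_exp_neg hn2 hα0.le)
    have hmap : (gaussianFamily d n).real (orthonormalize ⁻¹'
        {w | 1 / 128 * (√(p : ℝ) / ((p : ℝ) + r) + √(q : ℝ) / ((q : ℝ) + r)) ≤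
          ∑ j, |distS w j - distT w j|}) ≤ (randomOrthonormal d n).real
        {w | 1 / 128 * (√(p : ℝ) / ((p : ℝ) + r) + √(q : ℝ) / ((q : ℝ) + r)) ≤
          ∑ j, |distS w j - distT w j|} :=
      ENNReal.toReal_mono (measure_ne_top _ _)
        (Measure.le_map_apply measurable_orthonormalize.aemeasurable _)
    refine le_trans ?_ hmap
    set A := orthonormalize (d := d) (m := n) ⁻¹'
      {w | 1 / 128 * (√(p : ℝ) / ((p : ℝ) + r) + √(q : ℝ) / ((q : ℝ) + r)) ≤
          ∑ j, |distS w j - distT w j|} with hA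
    have hcompl : (gaussianFamily d n).real Aᶜ ≤ Real.exp (-α) := by
      refine (measureReal_mono fun y hy => ?_).trans hbad'
      simp only [hA, Set.mem_compl_iff, Set.mem_preimage, Set.mem_ofPred_eq, not_le] at hy
      exact hy
    have hadd := measureReal_union_le (μ := gaussianFamily d n) A Aᶜ
    rw [Set.union_compl_self, probReal_univ] at hadd
    linarith
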